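/- A state of the box-ball system is a finite set $S\subset\mathbb Z$ of filled boxes (each holding one ball). In one time step every ball is moved exactly once, from the left-most to the right-most, each to the left-most box to its right that is empty at that moment. This evolution is invertible, so each state $S$ (at time $0$) determines states at all times $t\in\mathbb Z$. A block is a maximal set of consecutive filled boxes; its size is its number of balls, and its position is the label of its left-most box. An $n$-soliton system has asymptotic block sizes $\mu_1<\mu_2<\dots<\mu_n$ if for all sufficiently large times $t$ the state at time $t$ has exactly $n$ blocks and their sizes are $\mu_1,\dots,\mu_n$ (in no prescribed spatial order). When the state at time $s$ has exactly one block of size $m$, at position $a$, and the state at time $t$ has exactly one block of size $m$, at position $b$, the phase shift of the block of size $m$ from time $s$ to time $t$ is $b-\bigl(a+(t-s)m\bigr)$, the displacement from the position that the block would have reached by travelling freely with velocity $m$. **Theorem.** Consider an $n$-soliton box-ball system with asymptotic block sizes $\mu_1<\mu_2<\dots<\mu_n$, and for $i\in\{1,\dots,n\}$ put $$\hat\Phi_i=\sum_{j<i}2\mu_j-\sum_{j>i}2\mu_i .$$ Then for all sufficiently large $t$ and every $i\in\{1,\dots,n\}$, the states at times $-t$ and $t$ each contain exactly one block of size $\mu_i$,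 and the phase shift $\Phi_i$ of the $\mu_i$-block from time $-t$ to time $t$ equals $\hat\Phi_i$. No restriction is placed on the collisions; in particular simultaneous multiple collisions are allowed. -/

import Mathlib

open Filter
open scoped Pointwise

/-- A state of the box-ball system: the (finite) set of filled boxes among the boxes labelled by
the integers. -/
abbrev BoxBallState : Type := Finset ℤ

namespace BoxBall

theorem exists_empty_right (S : Finset ℤ) (b : ℤ) : ∃ k : ℕ, b + 1 + (k : ℤ) ∉ S := by
  obtain ⟨M, hM⟩ := S.bddAbove
  refine ⟨(M - b).toNat, fun h => ?_⟩
  have h1 := hM (Finset.mem_coe.2 h)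
  have h2 := Int.self_le_toNat (M - b)
  linarith

/-- The left-most empty box strictly to the right of box `b`. -/
def firstEmpty (S : BoxBallState) (b : ℤ) : ℤ :=
  b + 1 + (Nat.find (exists_empty_right S b) : ℤ)

/-- Move the ball in box `b` to the left-most empty box to its right. -/
def move (S : BoxBallState) (b : ℤ) : BoxBallState :=
  insert (firstEmpty S b) (S.erase b)

/-- One time step of the box-ball system: every ball of the configuration is moved exactly once,
starting with the left-most one, each to the left-most box to its right that is empty at that
moment. -/
def step (S : BoxBallState) : BoxBallState :=
  (S.sort (· ≤ ·)).foldl move S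

/-- The mirror image of `step`: every ball is moved exactly once, starting with the right-most
one, each to the right-most box to its left that is empty at that moment. -/
def stepBack (S : BoxBallState) : BoxBallState := -step (-S)

/-! ### `step` and `stepBack` are inverse to each other -/

theorem firstEmpty_notMem (S : Finset ℤ) (b : ℤ) : firstEmpty S b ∉ S :=
  Nat.find_spec (exists_empty_right S b)

theorem lt_firstEmpty (S : Finset ℤ) (b : ℤ) : b < firstEmpty S b := by
  unfold firstEmpty; omega

theorem mem_of_lt_firstEmpty {S : Finset ℤ} {b x : ℤ} (h1 : b < x) (h2 : x < firstEmpty S b) :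
    x ∈ S := by
  have h3 : (x - b - 1).toNat < Nat.find (exists_empty_right S b) := by
    unfold firstEmpty at h2; omega
  have h4 := Nat.find_min (exists_empty_right S b) h3
  have h5 : b + 1 + ((x - b - 1).toNat : ℤ) = x := by omega
  rw [h5] at h4
  exact not_not.1 h4

theorem firstEmpty_eq {S : Finset ℤ} {b x : ℤ} (h1 : b < x) (h2 : x ∉ S)
    (h3 : ∀ y, b < y → y < x → y ∈ S) : firstEmpty S b = x := by
  rcases lt_trichotomy (firstEmpty S b) x with h | h | h
  · exact absurd (h3 _ (lt_firstEmpty S b) h) (firstEmpty_notMem S b)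
  · exact h
  · exact absurd (mem_of_lt_firstEmpty h1 h) h2

/-- The list of boxes to which the balls in the list of boxes `l` are moved, one after another. -/
def targets : List ℤ → Finset ℤ → List ℤ
  | [], _ => []
  | b :: l, C => firstEmpty C b :: targets l (move C b)

theorem move_back {C : Finset ℤ} {b : ℤ} (hb : b ∈ C) :
    -move (-(move C b)) (-firstEmpty C b) = C := by
  have h0 := lt_firstEmpty C b
  have h1 := firstEmpty_notMem C b
  have h : firstEmpty (-(move C b)) (-firstEmpty C b) = -b := by
    apply firstEmpty_eq
    · omega
    · simp only [Finset.mem_neg', neg_neg, move, Finset.mem_insert, Finset.mem_erase]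
      rintro (h | h)
      · omega
      · exact h.1 rfl
    · intro y hy1 hy2
      simp only [Finset.mem_neg', move, Finset.mem_insert, Finset.mem_erase]
      exact Or.inr ⟨by omega, mem_of_lt_firstEmpty (b := b) (by omega) (by omega)⟩
  ext x
  rw [Finset.mem_neg', move, h]
  simp only [Finset.mem_neg', move, Finset.mem_insert, Finset.mem_erase, neg_neg, neg_inj]
  constructor
  · rintro (h | ⟨h, h' | h'⟩)
    · exact h ▸ hb
    · exact absurd (congrArg Neg.neg h') h
    · exact h'.2
  · intro hx
    by_cases hxb : x = b
    · exact Or.inl hxb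
    · exact Or.inr ⟨fun h => h1 ((neg_inj.1 h) ▸ hx), Or.inr ⟨hxb, hx⟩⟩

theorem mem_move_of_mem {C : Finset ℤ} {b c : ℤ} (hc : c ∈ C) (hbc : b < c) : c ∈ move C b :=
  Finset.mem_insert_of_mem (Finset.mem_erase.2 ⟨hbc.ne', hc⟩)

theorem targets_back (l : List ℤ) (C : Finset ℤ) (hl : l.Pairwise (· < ·))
    (hC : ∀ b ∈ l, b ∈ C) :
    (targets l C).foldr (fun e T => -move (-T) (-e)) (l.foldl move C) = C := by
  induction l generalizing C with
  | nil => rfl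
  | cons b l ih =>
    rw [List.pairwise_cons] at hl
    simp only [targets, List.foldr_cons, List.foldl_cons]
    rw [ih (move C b) hl.2
      (fun c hc => mem_move_of_mem (hC c (List.mem_cons_of_mem _ hc)) (hl.1 c hc))]
    exact move_back (hC b List.mem_cons_self)

theorem targets_lt (l : List ℤ) (C : Finset ℤ) (a : ℤ) (hl : l.Pairwise (· < ·))
    (hC : ∀ b ∈ l, b ∈ C) (ha : ∀ b ∈ l, ∀ y, b < y → y ≤ a → y ∈ C) :
    (∀ e ∈ targets l C, a < e) ∧ (targets l C).Pairwise (· < ·) := by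
  induction l generalizing C a with
  | nil => simp [targets]
  | cons b l ih =>
    rw [List.pairwise_cons] at hl
    have hae : a < firstEmpty C b := by
      by_contra h
      exact firstEmpty_notMem C b
        (ha b List.mem_cons_self _ (lt_firstEmpty C b) (not_lt.1 h))
    obtain ⟨h1, h2⟩ := ih (move C b) (firstEmpty C b) hl.2
      (fun c hc => mem_move_of_mem (hC c (List.mem_cons_of_mem _ hc)) (hl.1 c hc))
      (by
        intro c hc y hy1 hy2
        have := hl.1 c hc
        rcases hy2.eq_or_lt with h | h
        · exact h ▸ Finset.mem_insert_self _ _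
        · exact mem_move_of_mem (mem_of_lt_firstEmpty (by omega) h) (by omega))
    simp only [targets, List.mem_cons, forall_eq_or_imp, List.pairwise_cons]
    exact ⟨⟨hae, fun e he => hae.trans (h1 e he)⟩, h1, h2⟩

theorem mem_foldl_move (l : List ℤ) (C : Finset ℤ) (hl : l.Pairwise (· < ·))
    (hC : ∀ b ∈ l, b ∈ C) (x : ℤ) :
    x ∈ l.foldl move C ↔ (x ∈ C ∧ x ∉ l) ∨ x ∈ targets l C := by
  induction l generalizing C with
  | nil => simp [targets]
  | cons b l ih =>
    rw [List.pairwise_cons] at hl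
    rw [List.foldl_cons, ih (move C b) hl.2
      (fun c hc => mem_move_of_mem (hC c (List.mem_cons_of_mem _ hc)) (hl.1 c hc))]
    have h1 : firstEmpty C b ∉ l := fun h =>
      firstEmpty_notMem C b (hC _ (List.mem_cons_of_mem _ h))
    simp only [targets, List.mem_cons, move, Finset.mem_insert, Finset.mem_erase]
    constructor
    · rintro (⟨h | h, h'⟩ | h)
      · exact Or.inr (Or.inl h)
      · exact Or.inl ⟨h.2, fun hh => hh.elim h.1 h'⟩
      · exact Or.inr (Or.inr h)
    · rintro (⟨h, h'⟩ | h | h)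
      · exact Or.inl ⟨Or.inr ⟨fun hh => h' (Or.inl hh), h⟩, fun hh => h' (Or.inr hh)⟩
      · exact Or.inl ⟨Or.inl h, h ▸ h1⟩
      · exact Or.inr h

theorem sort_eq_of_pairwise {S : Finset ℤ} {l : List ℤ} (hl : l.Pairwise (· < ·))
    (h : ∀ x, x ∈ S ↔ x ∈ l) : S.sort (· ≤ ·) = l := by
  have h1 : S = l.toFinset := by ext x; simp [h]
  have h2 : l.Nodup := hl.imp (fun h => h.ne)
  rw [h1]
  exact (List.toFinset_sort (· ≤ ·) h2).2 (hl.imp (fun h => h.le))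

theorem sort_lt (S : Finset ℤ) : (S.sort (· ≤ ·)).Pairwise (· < ·) :=
  Finset.sortedLT_sort S |>.pairwise

theorem stepBack_step (S : Finset ℤ) : stepBack (step S) = S := by
  have hS : ∀ b ∈ S.sort (· ≤ ·), b ∈ S := fun b hb => (Finset.mem_sort _).1 hb
  have hp : (targets (S.sort (· ≤ ·)) S).Pairwise (· < ·) := by
    obtain ⟨m, hm⟩ := S.bddBelow
    exact (targets_lt _ S m (sort_lt S) hS (fun b hb y h1 h2 => absurd
      (hm (Finset.mem_coe.2 (hS b hb))) (by omega))).2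
  have hmem : ∀ x, x ∈ -step S ↔ x ∈ ((targets (S.sort (· ≤ ·)) S).map (- ·)).reverse := by
    intro x
    rw [Finset.mem_neg', step, mem_foldl_move _ _ (sort_lt S) hS, List.mem_reverse]
    simp only [Finset.mem_sort, and_not_self_iff, false_or, List.mem_map]
    exact ⟨fun h => ⟨_, h, neg_neg x⟩, by rintro ⟨a, ha, rfl⟩; rwa [neg_neg]⟩
  have hsort := sort_eq_of_pairwise (by
    rw [List.pairwise_reverse, List.pairwise_map]
    exact hp.imp (fun h => neg_lt_neg h)) hmem
  have key := targets_back _ S (sort_lt S) hS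
  have hfold : ∀ (l : List ℤ) (T : Finset ℤ),
      -((l.map (- ·)).foldr (fun e T => move T e) (-T)) =
        l.foldr (fun e T => -move (-T) (-e)) T := by
    intro l T
    induction l with
    | nil => simp
    | cons e l ih => simp only [List.map_cons, List.foldr_cons, ← ih, neg_neg]
  rw [stepBack, step, hsort, List.foldl_reverse, hfold]
  exact key

theorem step_stepBack (S : Finset ℤ) : step (stepBack S) = S := by
  have h := stepBack_step (-S)
  have h' : -step (stepBack S) = -S := h
  exact neg_injective h'

/-- The box-ball evolution as a permutation of the set of states. The state at time `t : ℤ` of the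
system that is in state `S` at time `0` is `(evolution ^ t) S`. -/
def evolution : Equiv.Perm BoxBallState where
  toFun := step
  invFun := stepBack
  left_inv := stepBack_step
  right_inv := step_stepBack

/-! ### Blocks, asymptotic block sizes and phase shifts -/

/-- The positions of the first (left-most) balls of the blocks, i.e. of the maximal sets of
consecutive filled boxes. -/
def blockStarts (S : BoxBallState) : Finset ℤ := S.filter (fun a => a - 1 ∉ S)

/-- The number of balls of the block whose first ball is in box `a`. -/
def blockSize (S : BoxBallState) (a : ℤ) : ℕ := (firstEmpty S a - a).toNat

/-- The multiset of sizes of all blocks of a state. -/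
def blockSizes (S : BoxBallState) : Multiset ℕ := (blockStarts S).val.map (blockSize S)

/-- The system that is in state `S` at time `0` is an `n`-soliton with asymptotic block sizes
`μ 0, …, μ (n - 1)`: at all sufficiently late times its blocks have exactly these sizes (listed
with multiplicity, in no particular spatial order). -/
def HasAsymptoticBlockSizes (S : BoxBallState) {n : ℕ} (μ : Fin n → ℕ) : Prop :=
  ∀ᶠ t : ℕ in atTop, blockSizes ((evolution ^ (t : ℤ)) S) = Finset.univ.val.map μ

/-- The state `S` has exactly one block of size `m`, and the first ball of that block is in
box `a`. -/
def IsPositionOfBlock (S : BoxBallState) (m : ℕ) (a : ℤ) : Prop :=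
  ∀ x, (x ∈ blockStarts S ∧ blockSize S x = m) ↔ x = a

/-- `φ` is the phase shift that the block of size `m` experiences from time `s` to time `t`: the
position of that block at time `t` minus the position `a + (t - s) * m` which it would have if it
had travelled freely with velocity `m` from its position `a` at time `s`. -/
def IsPhaseShift (S : BoxBallState) (m : ℕ) (s t φ : ℤ) : Prop :=
  ∃ a b : ℤ, IsPositionOfBlock ((evolution ^ s) S) m a ∧
    IsPositionOfBlock ((evolution ^ t) S) m b ∧ φ = b - (a + (t - s) * (m : ℤ))

end BoxBall

/-!
Let `x t i` be the position of the first ball of block `i`, counted from the left, at time `t`. The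
new blocks of a time step start exactly where the old ones end (`blockStarts_step`), so the number
of blocks is constant and block `i` at time `t` fills the boxes from `x t i` to `x (t + 1) i - 1`.
The evolution law becomes a complementarity condition on the array `x` (`IsMolecule`,
`isMolecule_blockPos`): `x (t + 2) i ≤ x t (i + 1)`, a certain sum of second differences in time
(the load of the carrier) is nonnegative, and one of the two inequalities is an equality.

This condition is invariant under `x t i ↦ x t i - m * (2 * i + t)`, which shortens all blocks and
all gaps by `m` (`IsMolecule.sub_linear`). A lower bound for all block sizes at late times holds
for all block and gap lengths at all times (`IsMolecule.le_size_and_le_gap`), so `m` may be the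
smallest asymptotic size. Then the slowest soliton gets size zero and is at rest at late times. Its
position `p` is occupied by a particle at all times (`IsMolecule.exists_eq_of_eventually`), and
taking one particle at `p` away leaves a molecule with one particle less
(`IsMolecule.removeAt`). Induction on the number of particles gives the phase shifts
(`IsMolecule.eventually_atBot`): at early times all other particles are on the left of `p`, at late
times on its right, and the index shifts by which the frames differ produce the terms `2 * m`.

That the blocks are ordered by size and move freely at late times follows from the load being
nonnegative: the number of balls in the first `i + 1` blocks never increases, hence is eventually
constant (`IsMolecule.eventually_atTop_eq`).
-/

namespace BoxBall

/-! ### Molecules: the evolution in terms of block starts -/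

/-- A space-time array of `n` particles, `x t i` being the position of particle `i` at time `t`,
which obeys the evolution law of the boundaries of the blocks of a box-ball system: block `i` at
time `t` fills the boxes from `x t i` to `x (t + 1) i - 1`. The sum in `load_nonneg` is the number
of balls that the carrier of balls still holds when it has passed the new block `i`. This number is
nonnegative, and the new block ends either because the carrier is empty or because the next block
has been reached. Blocks and gaps of length zero are allowed. -/
structure IsMolecule (n : ℕ) (x : ℤ → ℕ → ℤ) : Prop where
  le_succ : ∀ t i, i < n → x t i ≤ x (t + 1) i
  gap : ∀ t i, i + 1 < n → x (t + 2) i ≤ x t (i + 1)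
  load_nonneg : ∀ t i, i < n →
    0 ≤ ∑ k ∈ Finset.range (i + 1), (2 * x (t + 1) k - x t k - x (t + 2) k)
  load_eq_zero_or : ∀ t i, i < n →
    ∑ k ∈ Finset.range (i + 1), (2 * x (t + 1) k - x t k - x (t + 2) k) = 0 ∨
      (i + 1 < n ∧ x (t + 2) i = x t (i + 1))

theorem forall_of_eventually_atTop {P : ℤ → Prop} (h : ∀ᶠ t in atTop, P t)
    (hs : ∀ t, P (t + 1) → P t) (t : ℤ) : P t := by
  obtain ⟨T, hT⟩ := eventually_atTop.1 h
  have key : ∀ k : ℕ, ∀ t : ℤ, T ≤ t + k → P t := by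
    intro k
    induction k with
    | zero => intro t ht; exact hT t (by simpa using ht)
    | succ k ih => intro t ht; exact hs t (ih (t + 1) (by push_cast at ht; omega))
  exact key (T - t).toNat t (by omega)

namespace IsMolecule

variable {n : ℕ} {x : ℤ → ℕ → ℤ}

theorem le_add_two (hx : IsMolecule n x) (t : ℤ) {i : ℕ} (hi : i < n) :
    x (t + 1) i ≤ x (t + 2) i := by
  have := hx.le_succ (t + 1) i hi
  rwa [add_assoc] at this

theorem monotoneOn_index (hx : IsMolecule n x) (t : ℤ) {i j : ℕ} (hij : i ≤ j) (hj : j < n) :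
    x t i ≤ x t j := by
  induction j, hij using Nat.le_induction with
  | base => exact le_rfl
  | succ j hij ih =>
    have h1 := hx.le_succ t j (by omega)
    have h2 := hx.le_add_two t (show j < n by omega)
    have h3 := hx.gap t j hj
    have h4 := ih (by omega)
    omega

/-- If the carrier is not empty in front of block `i`, then the preceding new block ends where
block `i` starts; otherwise block `i` is at least as long as the new block `i`. -/
theorem size_ge_or (hx : IsMolecule n x) (t : ℤ) {i : ℕ} (hi : i < n) :
    (∃ j, i = j + 1 ∧ x (t + 2) j = x t i) ∨
      x (t + 2) i - x (t + 1) i ≤ x (t + 1) i - x t i := by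
  have h1 := hx.load_nonneg t i hi
  cases i with
  | zero =>
    rw [Finset.sum_range_one] at h1
    right; omega
  | succ j =>
    rcases hx.load_eq_zero_or t j (by omega) with h | h
    · rw [Finset.sum_range_succ, h] at h1
      right; omega
    · exact Or.inl ⟨j, rfl, h.2⟩

/-- A lower bound for the lengths of all blocks and gaps at late times holds at all times. -/
theorem le_size_and_le_gap (hx : IsMolecule n x) {m : ℤ}
    (h : ∀ᶠ t in atTop, ∀ i < n, m ≤ x (t + 1) i - x t i) (t : ℤ) :
    (∀ i < n, m ≤ x (t + 1) i - x t i) ∧ ∀ i, i + 1 < n → m ≤ x t (i + 1) - x (t + 1) i := by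
  refine forall_of_eventually_atTop (P := fun t => (∀ i < n, m ≤ x (t + 1) i - x t i) ∧
    ∀ i, i + 1 < n → m ≤ x t (i + 1) - x (t + 1) i) ?_ ?_ t
  · obtain ⟨T, hT⟩ := eventually_atTop.1 h
    filter_upwards [eventually_ge_atTop T] with t ht
    refine ⟨hT t ht, fun i hi => ?_⟩
    have h1 := hT (t + 1) (by omega) i (by omega)
    have h2 := hx.gap t i hi
    rw [add_assoc] at h1
    norm_num at h1
    omega
  · rintro t ⟨h1, h2⟩
    simp only [add_assoc, one_add_one_eq_two] at h1 h2
    constructor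
    · intro i hi
      have h3 := h1 i hi
      rcases hx.size_ge_or t hi with ⟨j, rfl, hj⟩ | h4
      · have := h2 j hi
        omega
      · omega
    · intro i hi
      have h3 := h1 i (by omega)
      have h4 := hx.gap t i hi
      omega

/-- Shortening all blocks and all gaps of a molecule by the same amount `m`. -/
theorem sub_linear (hx : IsMolecule n x) (m : ℤ)
    (h : ∀ t, (∀ i < n, m ≤ x (t + 1) i - x t i) ∧
      ∀ i, i + 1 < n → m ≤ x t (i + 1) - x (t + 1) i) :
    IsMolecule n (fun t i => x t i - m * (2 * i + t)) := by
  have hsum : ∀ (t : ℤ) (i : ℕ), ∑ k ∈ Finset.range (i + 1),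
      (2 * (x (t + 1) k - m * (2 * k + (t + 1))) - (x t k - m * (2 * k + t)) -
        (x (t + 2) k - m * (2 * k + (t + 2)))) =
      ∑ k ∈ Finset.range (i + 1), (2 * x (t + 1) k - x t k - x (t + 2) k) :=
    fun t i => Finset.sum_congr rfl (fun k _ => by ring)
  constructor
  · intro t i hi
    have := (h t).1 i hi
    linarith
  · intro t i hi
    have := hx.gap t i hi
    push_cast
    linarith
  · intro t i hi
    rw [hsum]
    exact hx.load_nonneg t i hi
  · intro t i hi
    rw [hsum]
    refine (hx.load_eq_zero_or t i hi).imp_right (fun h => ⟨h.1, ?_⟩)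
    push_cast
    linarith [h.2]

/-! ### A particle at rest -/

/-- A position that is occupied at two consecutive times was occupied before. -/
theorem exists_eq_of_exists_eq (hx : IsMolecule n x) {p t : ℤ} {k l : ℕ} (hk : k < n) (hl : l < n)
    (h1 : x (t + 1) k = p) (h2 : x (t + 2) l = p) : ∃ i < n, x t i = p := by
  rcases lt_or_ge l k with hlk | hlk
  · have h3 := hx.gap t l (by omega)
    have h4 := hx.monotoneOn_index t (show l + 1 ≤ k by omega) hk
    have h5 := hx.le_succ t k hk
    exact ⟨k, hk, by omega⟩
  · have h3 := hx.monotoneOn_index (t + 2) hlk hl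
    have h4 := hx.le_add_two t hk
    have h5 : x (t + 2) k = p := by omega
    rcases hx.load_eq_zero_or t k hk with h | ⟨h, h'⟩
    · have h6 : 0 ≤ ∑ k ∈ Finset.range k, (2 * x (t + 1) k - x t k - x (t + 2) k) := by
        cases k with
        | zero => simp
        | succ j => exact hx.load_nonneg t j (by omega)
      rw [Finset.sum_range_succ] at h
      have h7 := hx.le_succ t k hk
      exact ⟨k, hk, by omega⟩
    · exact ⟨k + 1, h, by omega⟩

theorem exists_eq_of_eventually (hx : IsMolecule n x) {p : ℤ}
    (h : ∀ᶠ t in atTop, ∃ i < n, x t i = p) (t : ℤ) : ∃ i < n, x t i = p := by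
  refine (forall_of_eventually_atTop (P := fun t => (∃ i < n, x t i = p) ∧
    ∃ i < n, x (t + 1) i = p) ?_ ?_ t).1
  · obtain ⟨T, hT⟩ := eventually_atTop.1 h
    filter_upwards [eventually_ge_atTop T] with t ht
    exact ⟨hT t ht, hT _ (by omega)⟩
  · rintro t ⟨⟨k, hk, h1⟩, ⟨l, hl, h2⟩⟩
    rw [add_assoc, one_add_one_eq_two] at h2
    exact ⟨hx.exists_eq_of_exists_eq hk hl h1 h2, k, hk, h1⟩

end IsMolecule

/-- The positions that remain when one particle at position `p` is taken away from the particles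
with the increasing positions `y`. -/
def removeAt (p : ℤ) (y : ℕ → ℤ) (j : ℕ) : ℤ := if y j < p then y j else y (j + 1)

theorem sum_removeAt_of_lt {n : ℕ} {y : ℕ → ℤ} {p : ℤ} {j : ℕ} (hj : j < n)
    (hy : ∀ k l, k ≤ l → l < n → y k ≤ y l) (h : y j < p) :
    ∑ k ∈ Finset.range (j + 1), removeAt p y k = ∑ k ∈ Finset.range (j + 1), y k := by
  refine Finset.sum_congr rfl (fun k hk => ?_)
  have := hy k j (by simpa [Nat.lt_succ_iff] using hk) hj
  rw [removeAt, if_pos (by omega)]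

theorem sum_removeAt_of_le {n : ℕ} {y : ℕ → ℤ} {p : ℤ} {j : ℕ} (hj : j + 1 < n)
    (hy : ∀ k l, k ≤ l → l < n → y k ≤ y l) (hp : ∃ i < n, y i = p) (h : p ≤ y j) :
    ∑ k ∈ Finset.range (j + 1), removeAt p y k =
      ∑ k ∈ Finset.range (j + 1 + 1), y k - p := by
  induction j with
  | zero =>
    obtain ⟨i, hi, rfl⟩ := hp
    have := hy 0 i (by omega) hi
    rw [Finset.sum_range_one, removeAt, if_neg (by omega), Finset.sum_range_succ,
      Finset.sum_range_one, zero_add]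
    omega
  | succ j ih =>
    rw [Finset.sum_range_succ _ (j + 1), removeAt, if_neg (by omega),
      Finset.sum_range_succ y (j + 1 + 1)]
    rcases lt_or_ge (y j) p with h' | h'
    · obtain ⟨i, hi, rfl⟩ := hp
      have : y (j + 1) ≤ y i := by
        rcases lt_or_ge j i with hji | hji
        · exact hy _ _ hji hi
        · have := hy i j hji (by omega)
          omega
      rw [sum_removeAt_of_lt (show j < n by omega) hy h', Finset.sum_range_succ y (j + 1)]
      omega
    · rw [ih (by omega) h']
      ring

namespace IsMolecule

variable {n : ℕ} {x : ℤ → ℕ → ℤ}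

/-- Taking away a particle at rest from a molecule leaves a molecule: a soliton of size zero does
not influence the others. -/
theorem removeAt (hx : IsMolecule (n + 1) x) {p : ℤ} (hp : ∀ t, ∃ i < n + 1, x t i = p) :
    IsMolecule n (fun t => BoxBall.removeAt p (x t)) := by
  have hm : ∀ t k l, k ≤ l → l < n + 1 → x t k ≤ x t l :=
    fun t k l h h' => hx.monotoneOn_index t h h'
  have hnext : ∀ t j, j < n → x t j < p → x t (j + 1) ≤ p := by
    intro t j hj h
    obtain ⟨i, hi, h'⟩ := hp t
    rcases lt_or_ge j i with hji | hji
    · exact h' ▸ hm t _ _ hji hi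
    · have := hm t i j hji (by omega)
      omega
  -- Seen from particle `j`, the resting particle changes sides at most once; in each case the
  -- load of the new molecule is that of particle `j` or `j + 1` of the old one.
  have hload : ∀ t j, j < n →
      ((x (t + 2) j < p ∧ ∑ k ∈ Finset.range (j + 1), (2 * BoxBall.removeAt p (x (t + 1)) k -
          BoxBall.removeAt p (x t) k - BoxBall.removeAt p (x (t + 2)) k) =
        ∑ k ∈ Finset.range (j + 1), (2 * x (t + 1) k - x t k - x (t + 2) k)) ∨
      (p ≤ x (t + 2) j ∧ p ≤ x t (j + 1) ∧
        ∑ k ∈ Finset.range (j + 1), (2 * BoxBall.removeAt p (x (t + 1)) k -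
          BoxBall.removeAt p (x t) k - BoxBall.removeAt p (x (t + 2)) k) =
        ∑ k ∈ Finset.range (j + 1 + 1), (2 * x (t + 1) k - x t k - x (t + 2) k))) := by
    intro t j hj
    have e1 := hx.le_succ t j (by omega)
    have e2 := hx.le_add_two t (show j < n + 1 by omega)
    have e3 := hx.gap t j (by omega)
    have e4 := hx.le_succ t (j + 1) (by omega)
    have L := fun t => sum_removeAt_of_lt (p := p) (show j < n + 1 by omega) (hm t)
    have R := fun t => sum_removeAt_of_le (show j + 1 < n + 1 by omega) (hm t) (hp t)
    have N := fun t => hnext t j hj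
    have N0 := N t
    have N1 := N (t + 1)
    simp only [Finset.sum_sub_distrib, ← Finset.mul_sum]
    rcases lt_or_ge (x (t + 2) j) p with h2 | h2
    · left
      rw [L t (by omega), L (t + 1) (by omega), L (t + 2) h2]
      exact ⟨h2, rfl⟩
    · right
      refine ⟨h2, by omega, ?_⟩
      rw [R (t + 2) h2]
      rcases lt_or_ge (x (t + 1) j) p with h1 | h1
      · have h0 : x t j < p := by omega
        rw [L (t + 1) h1, L t h0, Finset.sum_range_succ (x (t + 1)) (j + 1),
          Finset.sum_range_succ (x t) (j + 1)]
        have := N0 h0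
        have := N1 h1
        omega
      · rw [R (t + 1) h1]
        rcases lt_or_ge (x t j) p with h0 | h0
        · rw [L t h0, Finset.sum_range_succ (x t) (j + 1)]
          have := N0 h0
          omega
        · rw [R t h0]
          ring
  constructor
  · intro t j hj
    have e1 := hx.le_succ t j (by omega)
    have e2 := hx.le_succ t (j + 1) (by omega)
    have e3 := hm (t + 1) j (j + 1) (by omega) (by omega)
    have e4 := hnext t j hj
    simp only [BoxBall.removeAt]
    split_ifs <;> omega
  · intro t j hj
    have e1 := hx.gap t j (by omega)
    have e2 := hx.gap t (j + 1) (by omega)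
    have e3 := hnext (t + 2) j (by omega)
    have e4 := hm t (j + 1) (j + 1 + 1) (by omega) (by omega)
    simp only [BoxBall.removeAt]
    split_ifs <;> omega
  · intro t j hj
    rcases hload t j hj with ⟨-, h⟩ | ⟨-, -, h⟩
    · rw [h]; exact hx.load_nonneg t j (by omega)
    · rw [h]; exact hx.load_nonneg t (j + 1) (by omega)
  · intro t j hj
    rcases hload t j hj with ⟨h2, h⟩ | ⟨h2, h0, h⟩
    · rw [h]
      refine (hx.load_eq_zero_or t j (by omega)).imp_right (fun h' => ?_)
      have h3 : x t (j + 1) < p := h'.2 ▸ h2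
      refine ⟨?_, ?_⟩
      · obtain ⟨i, hi, h4⟩ := hp t
        by_contra hlt
        have := hm t i (j + 1) (by omega) (by omega)
        omega
      · simp only [BoxBall.removeAt]
        rw [if_pos h2, if_pos h3, h'.2]
    · rw [h]
      refine (hx.load_eq_zero_or t (j + 1) (by omega)).imp_right (fun h' => ⟨by omega, ?_⟩)
      simp only [BoxBall.removeAt]
      rw [if_neg (by omega), if_neg (by omega), h'.2]

/-! ### Phase shifts of molecules -/

/-- The phase shifts of a molecule. The particles of a molecule that move freely at late times,
with distinct velocities, move freely with the reversed order of velocities at early times. By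
induction on `n`: in a co-moving frame with shortened gaps the slowest particle is at rest and can
be taken away. -/
theorem eventually_atBot (hx : IsMolecule n x) {X μ : ℕ → ℤ}
    (hμ : ∀ i j, i < j → j < n → μ i < μ j)
    (hlate : ∀ᶠ t in atTop, ∀ i < n, x t i = X i + μ i * t) :
    ∀ᶠ t in atBot, ∀ i < n, x t (n - 1 - i) =
      X i - (∑ j ∈ Finset.range i, 2 * μ j - 2 * ((n - 1 - i : ℕ) : ℤ) * μ i) + μ i * t := by
  induction n generalizing x X μ with
  | zero => simp
  | succ n ih =>
    obtain ⟨T, hT⟩ := eventually_atTop.1 hlate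
    have hμ0 : ∀ i < n + 1, μ 0 ≤ μ i := fun i hi => by
      rcases Nat.eq_zero_or_pos i with rfl | h
      · exact le_rfl
      · exact (hμ 0 i h hi).le
    have hsize := hx.le_size_and_le_gap (m := μ 0) (by
      filter_upwards [eventually_ge_atTop T] with t ht i hi
      rw [hT t ht i hi, hT (t + 1) (by omega) i hi]
      linarith [hμ0 i hi])
    have hy := hx.sub_linear (μ 0) hsize
    set y : ℤ → ℕ → ℤ := fun t i => x t i - μ 0 * (2 * i + t) with hydef
    have hylate : ∀ t, T ≤ t → ∀ i < n + 1,
        y t i = (X i - 2 * μ 0 * i) + (μ i - μ 0) * t := by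
      intro t ht i hi
      simp only [hydef]
      rw [hT t ht i hi]
      ring
    have hp := hy.exists_eq_of_eventually (p := X 0) (by
      filter_upwards [eventually_ge_atTop T] with t ht
      exact ⟨0, by omega, by rw [hylate t ht 0 (by omega)]; simp⟩)
    have hz := ih (hy.removeAt hp) (X := fun j => X (j + 1) - 2 * μ 0 * (j + 1 : ℕ))
      (μ := fun j => μ (j + 1) - μ 0)
      (fun i j hij hj => by have := hμ (i + 1) (j + 1) (by omega) (by omega); omega) (by
      filter_upwards [eventually_ge_atTop T] with t ht j hj
      have h0 : y t 0 = X 0 := by rw [hylate t ht 0 (by omega)]; simp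
      have h1 := hy.monotoneOn_index t (show 0 ≤ j by omega) (show j < n + 1 by omega)
      simp only [BoxBall.removeAt]
      rw [if_neg (by omega), hylate t ht (j + 1) (by omega)])
    have hlt : ∀ᶠ t in atBot, ∀ j < n, BoxBall.removeAt (X 0) (y t) j < X 0 := by
      have : ∀ᶠ t : ℤ in atBot, ∀ i ∈ Finset.range n, X (i + 1) - 2 * μ 0 * (i + 1 : ℕ) -
          (∑ j ∈ Finset.range i, 2 * (μ (j + 1) - μ 0) -
            2 * ((n - 1 - i : ℕ) : ℤ) * (μ (i + 1) - μ 0)) + (μ (i + 1) - μ 0) * t < X 0 := by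
        rw [eventually_all_finset]
        intro i hi
        generalize X (i + 1) - 2 * μ 0 * (i + 1 : ℕ) -
          (∑ j ∈ Finset.range i, 2 * (μ (j + 1) - μ 0) -
            2 * ((n - 1 - i : ℕ) : ℤ) * (μ (i + 1) - μ 0)) = c
        filter_upwards [eventually_le_atBot (0 : ℤ), eventually_le_atBot (X 0 - c - 1)]
          with t h0 h1
        have := hμ 0 (i + 1) (by omega) (by have := Finset.mem_range.1 hi; omega)
        nlinarith
      filter_upwards [hz, this] with t h1 h2 j hj
      have h3 := h1 (n - 1 - j) (by omega)
      rw [show n - 1 - (n - 1 - j) = j by omega] at h3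
      have h4 := h2 (n - 1 - j) (Finset.mem_range.2 (by omega))
      rw [show n - 1 - (n - 1 - j) = j by omega] at h4
      rw [h3]
      exact h4
    filter_upwards [hz, hlt] with t hzt hltt
    have hyz : ∀ j < n, y t j = BoxBall.removeAt (X 0) (y t) j ∧ y t j < X 0 := by
      intro j hj
      have h1 := hltt j hj
      have h2 := hy.monotoneOn_index t (show j ≤ j + 1 by omega) (by omega)
      simp only [BoxBall.removeAt] at h1 ⊢
      split_ifs at h1 ⊢ <;> omega
    intro i hi
    rcases Nat.eq_zero_or_pos i with rfl | hi0
    · obtain ⟨k, hk, hk'⟩ := hp t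
      have hkn : k = n := by
        by_contra hne
        have := (hyz k (by omega)).2
        omega
      subst hkn
      simp only [hydef] at hk'
      simp only [Nat.add_sub_cancel, Nat.sub_zero, Finset.range_zero, Finset.sum_empty]
      linarith
    · obtain ⟨i, rfl⟩ : ∃ k, i = k + 1 := ⟨i - 1, by omega⟩
      have h1 := hzt i (by omega)
      rw [← (hyz (n - 1 - i) (by omega)).1] at h1
      rw [show n + 1 - 1 - (i + 1) = n - 1 - i by omega]
      simp only [hydef] at h1
      have h2 : ((n - 1 - i : ℕ) : ℤ) = n - 1 - i := by omega
      rw [Finset.sum_range_succ', h2]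
      rw [h2] at h1
      have h3 : ∑ j ∈ Finset.range i, 2 * (μ (j + 1) - μ 0) =
          ∑ j ∈ Finset.range i, 2 * μ (j + 1) - 2 * i * μ 0 := by
        simp only [mul_sub, Finset.sum_sub_distrib]
        simp
        ring
      rw [h3] at h1
      push_cast at h1
      linear_combination h1

/-- Since the load is nonnegative, the first `i + 1` blocks never gain balls; so their sizes are
constant from some time on. -/
theorem eventually_atTop_eq (hx : IsMolecule n x) :
    ∃ X v : ℕ → ℤ, (∀ i j, i ≤ j → j < n → v i ≤ v j) ∧
      ∀ᶠ t in atTop, ∀ i < n, x t i = X i + v i * t := by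
  have hB : ∀ i < n, ∃ T : ℕ, ∀ t ≥ T,
      ∑ k ∈ Finset.range (i + 1), (x ((t : ℤ) + 1) k - x t k) =
        ∑ k ∈ Finset.range (i + 1), (x ((T : ℤ) + 1) k - x T k) := by
    intro i hi
    set B : ℕ → ℤ := fun t => ∑ k ∈ Finset.range (i + 1), (x ((t : ℤ) + 1) k - x t k) with hBdef
    have hanti : Antitone B := antitone_nat_of_succ_le (fun t => by
      have h := hx.load_nonneg t i hi
      simp only [hBdef]
      push_cast
      rw [add_assoc, one_add_one_eq_two, ← sub_nonneg, ← Finset.sum_sub_distrib]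
      refine h.trans_eq (Finset.sum_congr rfl (fun k _ => by ring)))
    have hnn : ∀ t, 0 ≤ B t := fun t => Finset.sum_nonneg (fun k hk => by
      have := hx.le_succ t k (by have := Finset.mem_range.1 hk; omega)
      omega)
    refine ⟨Function.argmin (fun t => (B t).toNat), fun t ht => ?_⟩
    have h1 := Function.argmin_le (fun t => (B t).toNat) t
    have h2 := hanti ht
    have h3 := hnn t
    have h4 := hnn (Function.argmin (fun t => (B t).toNat))
    have h5 : B t = B (Function.argmin (fun t => (B t).toNat)) := by omega
    exact h5
  choose! T hT using hB
  set M := (Finset.range n).sup T with hM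
  have hTM : ∀ i < n, T i ≤ M := fun i hi => Finset.le_sup (Finset.mem_range.2 hi)
  have hB' : ∀ i < n, ∀ t : ℕ, M ≤ t →
      ∑ k ∈ Finset.range (i + 1), (x ((t : ℤ) + 1) k - x t k) =
        ∑ k ∈ Finset.range (i + 1), (x ((M : ℤ) + 1) k - x M k) := fun i hi t ht =>
    (hT i hi t ((hTM i hi).trans ht)).trans (hT i hi M (hTM i hi)).symm
  have hv : ∀ i < n, ∀ t : ℕ, M ≤ t → x ((t : ℤ) + 1) i - x t i = x ((M : ℤ) + 1) i - x M i := by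
    intro i hi t ht
    have h1 := hB' i hi t ht
    cases i with
    | zero => simpa using h1
    | succ j =>
      have h2 := hB' j (by omega) t ht
      rw [Finset.sum_range_succ, Finset.sum_range_succ _ (j + 1), h2] at h1
      linarith
  have hfree : ∀ i < n, ∀ t : ℤ, (M : ℤ) ≤ t →
      x t i = x M i - (x ((M : ℤ) + 1) i - x M i) * M + (x ((M : ℤ) + 1) i - x M i) * t := by
    intro i hi t ht
    induction t, ht using Int.leInduction with
    | base => ring
    | succ t ht ih =>
      lift t to ℕ using by omega
      have := hv i hi t (by exact_mod_cast ht)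
      linear_combination this + ih
  refine ⟨_, fun i => x ((M : ℤ) + 1) i - x M i, ?_,
    (eventually_ge_atTop (M : ℤ)).mono (fun t ht i hi => hfree i hi t ht)⟩
  intro i j hij hj
  -- Two particles which stay in order forever cannot approach each other.
  by_contra! hlt
  have h1 := hfree i (by omega)
  have h2 := hfree j hj
  have h0 := hx.monotoneOn_index M hij hj
  obtain ⟨d, hd⟩ : ∃ d, d = x M j - x M i := ⟨_, rfl⟩
  have h3 := hx.monotoneOn_index ((M : ℤ) + (d + 1)) hij hj
  rw [h1 _ (by omega), h2 _ (by omega)] at h3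
  nlinarith

end IsMolecule
end BoxBall

namespace BoxBall

/-! ### The carrier description of a time step -/

theorem targets_notMem (l : List ℤ) (C : Finset ℤ) (hl : l.Pairwise (· < ·))
    (hC : ∀ b ∈ l, b ∈ C) : ∀ e ∈ targets l C, e ∉ C := by
  induction l generalizing C with
  | nil => simp [targets]
  | cons b l ih =>
    rw [List.pairwise_cons] at hl
    have hC' : ∀ c ∈ l, c ∈ move C b :=
      fun c hc => mem_move_of_mem (hC c (List.mem_cons_of_mem _ hc)) (hl.1 c hc)
    simp only [targets, List.mem_cons, forall_eq_or_imp]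
    refine ⟨firstEmpty_notMem C b, fun e he heC => ih (move C b) hl.2 hC' e he ?_⟩
    have h1 := (targets_lt l (move C b) b hl.2 hC'
      (fun c hc y h2 h3 => by have := hl.1 c hc; omega)).1 e he
    exact mem_move_of_mem heC h1

theorem countP_targets_le (l : List ℤ) (C : Finset ℤ) (y : ℤ) :
    (targets l C).countP (· < y) ≤ l.countP (· < y) := by
  induction l generalizing C with
  | nil => simp [targets]
  | cons b l ih =>
    have h1 := ih (move C b)
    have h2 := lt_firstEmpty C b
    simp only [targets, List.countP_cons, decide_eq_true_eq]
    split_ifs <;> omega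

theorem countP_le_targets (l : List ℤ) (C : Finset ℤ) (hl : l.Pairwise (· < ·)) {y : ℤ}
    (hy : y ∉ C) (hy' : y ∉ targets l C) :
    l.countP (· < y) ≤ (targets l C).countP (· < y) := by
  induction l generalizing C with
  | nil => simp
  | cons b l ih =>
    rw [List.pairwise_cons] at hl
    simp only [targets, List.mem_cons, not_or] at hy'
    have h2 : b < y → firstEmpty C b < y := by
      intro h
      by_contra h'
      exact hy (mem_of_lt_firstEmpty h (by omega))
    have h3 : y ∉ move C b := by
      simp only [move, Finset.mem_insert, Finset.mem_erase, not_or, not_and]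
      exact ⟨hy'.1, fun _ => hy⟩
    have h1 := ih (move C b) hl.2 h3 hy'.2
    simp only [targets, List.countP_cons, decide_eq_true_eq]
    split_ifs <;> omega

theorem mem_step {S : Finset ℤ} {x : ℤ} : x ∈ step S ↔ x ∈ targets (S.sort (· ≤ ·)) S := by
  rw [step, mem_foldl_move _ _ (sort_lt S) (fun _ hb => (Finset.mem_sort _).1 hb)]
  simp

theorem notMem_of_mem_step {S : Finset ℤ} {x : ℤ} (h : x ∈ step S) : x ∉ S :=
  targets_notMem _ S (sort_lt S) (fun _ hb => (Finset.mem_sort _).1 hb) x (mem_step.1 h)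

theorem card_filter_eq_countP {S : Finset ℤ} {l : List ℤ} (hl : l.Pairwise (· < ·))
    (h : ∀ x, x ∈ S ↔ x ∈ l) (y : ℤ) : (S.filter (· < y)).card = l.countP (· < y) := by
  have h1 : S.filter (· < y) = (l.filter (· < y)).toFinset := by
    ext x
    simp [h]
  rw [h1, List.toFinset_card_of_nodup ((hl.imp (fun h => h.ne)).filter _),
    List.countP_eq_length_filter]

theorem card_filter_step (S : Finset ℤ) (y : ℤ) :
    ((step S).filter (· < y)).card = (targets (S.sort (· ≤ ·)) S).countP (· < y) := by
  refine card_filter_eq_countP ?_ (fun _ => mem_step) y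
  obtain ⟨m, hm⟩ := S.bddBelow
  have hS : ∀ b ∈ S.sort (· ≤ ·), b ∈ S := fun b hb => (Finset.mem_sort _).1 hb
  exact (targets_lt _ S m (sort_lt S) hS (fun b hb y h1 h2 => absurd
    (hm (Finset.mem_coe.2 (hS b hb))) (by omega))).2

theorem card_filter_sort (S : Finset ℤ) (y : ℤ) :
    (S.filter (· < y)).card = (S.sort (· ≤ ·)).countP (· < y) :=
  card_filter_eq_countP (sort_lt S) (fun _ => (Finset.mem_sort _).symm) y

/-- The number of balls that have passed the border of box `y` is nonnegative. -/
theorem card_filter_step_le (S : Finset ℤ) (y : ℤ) :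
    ((step S).filter (· < y)).card ≤ (S.filter (· < y)).card := by
  rw [card_filter_step, card_filter_sort]
  exact countP_targets_le _ _ _

/-- A box that stays empty is passed by no ball. -/
theorem card_filter_step_eq {S : Finset ℤ} {y : ℤ} (h : y ∉ S) (h' : y ∉ step S) :
    ((step S).filter (· < y)).card = (S.filter (· < y)).card := by
  refine (card_filter_step_le S y).antisymm ?_
  rw [card_filter_step, card_filter_sort]
  exact countP_le_targets _ _ (sort_lt S) h (fun hy => h' (mem_step.2 hy))

/-! ### Block starts and block ends -/

theorem mem_blockStarts {S : Finset ℤ} {a : ℤ} : a ∈ blockStarts S ↔ a ∈ S ∧ a - 1 ∉ S := by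
  simp [blockStarts]

theorem firstEmpty_lt_of_mem_blockStarts {S : Finset ℤ} {a b : ℤ} (ha : a ∈ blockStarts S)
    (hb : b ∈ blockStarts S) (hab : a < b) : firstEmpty S a < b := by
  rw [mem_blockStarts] at ha hb
  by_contra h
  have h1 : a ≠ b - 1 := fun h => hb.2 (h ▸ ha.1)
  exact hb.2 (mem_of_lt_firstEmpty (b := a) (by omega) (by omega))

theorem exists_blockStart {S : Finset ℤ} {y : ℤ} (hy : y ∈ S) :
    ∃ a ∈ blockStarts S, a ≤ y ∧ ∀ z, a ≤ z → z ≤ y → z ∈ S := by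
  obtain ⟨m, hm⟩ := S.bddBelow
  have key : ∀ k : ℕ, ∀ y ∈ S, y ≤ m + k →
      ∃ a ∈ blockStarts S, a ≤ y ∧ ∀ z, a ≤ z → z ≤ y → z ∈ S := by
    intro k
    induction k with
    | zero =>
      intro y hy hym
      refine ⟨y, mem_blockStarts.2 ⟨hy, fun h => ?_⟩, le_rfl, fun z h1 h2 => ?_⟩
      · have := hm (Finset.mem_coe.2 h)
        push_cast at hym
        omega
      · rwa [show z = y by omega]
    | succ k ih =>
      intro y hy hym
      by_cases h : y - 1 ∈ S
      · obtain ⟨a, ha, h1, h2⟩ := ih (y - 1) h (by push_cast at hym; omega)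
        refine ⟨a, ha, by omega, fun z h3 h4 => ?_⟩
        rcases h4.eq_or_lt with rfl | h4
        · exact hy
        · exact h2 z h3 (by omega)
      · refine ⟨y, mem_blockStarts.2 ⟨hy, h⟩, le_rfl, fun z h1 h2 => ?_⟩
        rwa [show z = y by omega]
  exact key (y - m).toNat y hy (by omega)

theorem mem_iff_exists_blockStart {S : Finset ℤ} {y : ℤ} :
    y ∈ S ↔ ∃ a ∈ blockStarts S, a ≤ y ∧ y < firstEmpty S a := by
  constructor
  · intro hy
    obtain ⟨a, ha, h1, h2⟩ := exists_blockStart hy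
    refine ⟨a, ha, h1, ?_⟩
    by_contra h
    exact firstEmpty_notMem S a (h2 _ (lt_firstEmpty S a).le (not_lt.1 h))
  · rintro ⟨a, ha, h1, h2⟩
    rcases h1.eq_or_lt with rfl | h1
    · exact (mem_blockStarts.1 ha).1
    · exact mem_of_lt_firstEmpty h1 h2

/-- The box right after a block is always filled in the next time step, whereas of two adjacent
empty boxes the right one is filled only if the left one is. So the new blocks start where the old
ones end. -/
theorem blockStarts_step (S : Finset ℤ) :
    blockStarts (step S) = (blockStarts S).image (firstEmpty S) := by
  ext y
  rw [mem_blockStarts, Finset.mem_image]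
  constructor
  · rintro ⟨h1, h2⟩
    have h3 := notMem_of_mem_step h1
    have h4 : y - 1 ∈ S := by
      by_contra h4
      -- The carrier would have to be empty at `y - 1` and nonempty at `y`.
      have h5 := card_filter_step_eq h4 h2
      have h6 := card_filter_step_le S (y + 1)
      have h7 : (step S).filter (· < y + 1) = insert y ((step S).filter (· < y - 1)) := by
        ext z
        simp only [Finset.mem_filter, Finset.mem_insert]
        constructor
        · rintro ⟨hz, hzy⟩
          have : z ≠ y - 1 := fun h => h2 (h ▸ hz)
          by_cases hzy' : z = y
          · exact Or.inl hzy'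
          · exact Or.inr ⟨hz, by omega⟩
        · rintro (rfl | h)
          · exact ⟨h1, by omega⟩
          · exact ⟨h.1, by omega⟩
      have h8 : S.filter (· < y + 1) = S.filter (· < y - 1) := by
        ext z
        simp only [Finset.mem_filter]
        refine and_congr_right (fun hz => ⟨fun h => ?_, fun h => by omega⟩)
        have h9 : z ≠ y := fun h => h3 (h ▸ hz)
        have h10 : z ≠ y - 1 := fun h => h4 (h ▸ hz)
        omega
      rw [h7, h8, Finset.card_insert_of_notMem (by simp), h5] at h6
      omega
    obtain ⟨a, ha, h5, h6⟩ := exists_blockStart h4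
    exact ⟨a, ha, firstEmpty_eq (by omega) h3 (fun z h7 h8 => h6 z h7.le (by omega))⟩
  · rintro ⟨a, ha, rfl⟩
    have h1 := lt_firstEmpty S a
    have h2 := firstEmpty_notMem S a
    have h3 : firstEmpty S a - 1 ∈ S :=
      mem_iff_exists_blockStart.2 ⟨a, ha, by omega, by omega⟩
    refine ⟨?_, fun h => notMem_of_mem_step h h3⟩
    by_contra h4
    have h5 := card_filter_step_eq h2 h4
    have h6 := card_filter_step_le S (firstEmpty S a - 1)
    have h7 : S.filter (· < firstEmpty S a) =
        insert (firstEmpty S a - 1) (S.filter (· < firstEmpty S a - 1)) := by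
      ext z
      simp only [Finset.mem_filter, Finset.mem_insert]
      constructor
      · rintro ⟨hz, hzy⟩
        by_cases hzy' : z = firstEmpty S a - 1
        · exact Or.inl hzy'
        · exact Or.inr ⟨hz, by omega⟩
      · rintro (rfl | h)
        · exact ⟨h3, by omega⟩
        · exact ⟨h.1, by omega⟩
    have h8 : (step S).filter (· < firstEmpty S a) =
        (step S).filter (· < firstEmpty S a - 1) := by
      ext z
      simp only [Finset.mem_filter]
      refine and_congr_right (fun hz => ⟨fun h => ?_, fun h => by omega⟩)
      have h9 : z ≠ firstEmpty S a - 1 := fun h => notMem_of_mem_step hz (h ▸ h3)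
      omega
    rw [h7, h8, Finset.card_insert_of_notMem (by simp)] at h5
    omega

theorem firstEmpty_strictMonoOn (S : Finset ℤ) : StrictMonoOn (firstEmpty S) (blockStarts S) :=
  fun _ ha _ hb hab => (firstEmpty_lt_of_mem_blockStarts ha hb hab).trans (lt_firstEmpty S _)

theorem card_blockStarts_step (S : Finset ℤ) :
    (blockStarts (step S)).card = (blockStarts S).card := by
  rw [blockStarts_step, Finset.card_image_of_injOn (firstEmpty_strictMonoOn S).injOn]

theorem evolution_zpow_succ (S : BoxBallState) (t : ℤ) :
    (evolution ^ (t + 1)) S = step ((evolution ^ t) S) := by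
  rw [add_comm, zpow_add, zpow_one]
  rfl

theorem card_blockStarts_evolution (S : BoxBallState) (s t : ℤ) :
    (blockStarts ((evolution ^ s) S)).card = (blockStarts ((evolution ^ t) S)).card := by
  have h : ∀ t : ℤ, (blockStarts ((evolution ^ t) S)).card = (blockStarts S).card := by
    intro t
    induction t using Int.induction_on with
    | zero => rfl
    | succ t ih => rw [evolution_zpow_succ, card_blockStarts_step, ih]
    | pred t ih =>
      rw [← ih, ← card_blockStarts_step ((evolution ^ (-(t : ℤ) - 1)) S), ← evolution_zpow_succ]
      simp
  rw [h, h]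

/-! ### The molecule of a state -/

/-- The position of the first ball of the block number `i` (from the left, counted from `0`) at
time `t`, for the system in state `S` at time `0`. It is `0` if there is no such block. -/
def blockPos (S : BoxBallState) (t : ℤ) (i : ℕ) : ℤ :=
  ((blockStarts ((evolution ^ t) S)).sort (· ≤ ·)).getD i 0

variable {S : BoxBallState} {n : ℕ}

theorem blockPos_eq (t : ℤ) {i : ℕ}
    (hi : i < ((blockStarts ((evolution ^ t) S)).sort (· ≤ ·)).length) :
    blockPos S t i = ((blockStarts ((evolution ^ t) S)).sort (· ≤ ·))[i] := by
  rw [blockPos, List.getD_eq_getElem _ _ hi]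

theorem mem_blockStarts_iff (t : ℤ) (hn : (blockStarts ((evolution ^ t) S)).card = n) (a : ℤ) :
    a ∈ blockStarts ((evolution ^ t) S) ↔ ∃ i < n, blockPos S t i = a := by
  rw [← Finset.mem_sort (· ≤ ·), List.mem_iff_getElem]
  have hlen := (blockStarts ((evolution ^ t) S)).length_sort (· ≤ ·)
  rw [hn] at hlen
  constructor
  · rintro ⟨i, hi, h⟩
    exact ⟨i, hlen ▸ hi, (blockPos_eq t hi).trans h⟩
  · rintro ⟨i, hi, h⟩
    exact ⟨i, hlen.symm ▸ hi, (blockPos_eq t (hlen.symm ▸ hi)).symm.trans h⟩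

theorem blockPos_lt (t : ℤ) (hn : (blockStarts ((evolution ^ t) S)).card = n) {i j : ℕ}
    (hij : i < j) (hj : j < n) : blockPos S t i < blockPos S t j := by
  have hlen := (blockStarts ((evolution ^ t) S)).length_sort (· ≤ ·)
  rw [hn] at hlen
  rw [blockPos_eq t (by omega), blockPos_eq t (by omega)]
  exact List.pairwise_iff_getElem.1 (sort_lt _) i j (by omega) (by omega) hij

theorem blockPos_succ (t : ℤ) (hn : (blockStarts ((evolution ^ t) S)).card = n) {i : ℕ}
    (hi : i < n) : blockPos S (t + 1) i = firstEmpty ((evolution ^ t) S) (blockPos S t i) := by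
  have hlen := (blockStarts ((evolution ^ t) S)).length_sort (· ≤ ·)
  rw [hn] at hlen
  have h : (blockStarts ((evolution ^ (t + 1)) S)).sort (· ≤ ·) =
      ((blockStarts ((evolution ^ t) S)).sort (· ≤ ·)).map (firstEmpty ((evolution ^ t) S)) := by
    refine sort_eq_of_pairwise ?_ ?_
    · rw [List.pairwise_map]
      refine (sort_lt _).imp_of_mem (fun ha hb hab => ?_)
      exact firstEmpty_strictMonoOn _ ((Finset.mem_sort _).1 ha) ((Finset.mem_sort _).1 hb) hab
    · intro x
      rw [evolution_zpow_succ, blockStarts_step, Finset.mem_image, List.mem_map]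
      simp
  rw [blockPos_eq t (by omega), blockPos, h, List.getD_eq_getElem _ _ (by simp; omega),
    List.getElem_map]

theorem mem_evolution_iff (t : ℤ) (hn : (blockStarts ((evolution ^ t) S)).card = n) (y : ℤ) :
    y ∈ (evolution ^ t) S ↔ ∃ i < n, blockPos S t i ≤ y ∧ y < blockPos S (t + 1) i := by
  rw [mem_iff_exists_blockStart]
  constructor
  · rintro ⟨a, ha, h1, h2⟩
    obtain ⟨i, hi, rfl⟩ := (mem_blockStarts_iff t hn a).1 ha
    exact ⟨i, hi, h1, by rwa [blockPos_succ t hn hi]⟩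
  · rintro ⟨i, hi, h1, h2⟩
    exact ⟨_, (mem_blockStarts_iff t hn _).2 ⟨i, hi, rfl⟩, h1, by rwa [← blockPos_succ t hn hi]⟩

theorem blockPos_lt_succ (t : ℤ) (hn : (blockStarts ((evolution ^ t) S)).card = n) {i : ℕ}
    (hi : i < n) : blockPos S t i < blockPos S (t + 1) i := by
  rw [blockPos_succ t hn hi]
  exact lt_firstEmpty _ _

theorem blockPos_succ_lt (t : ℤ) (hn : (blockStarts ((evolution ^ t) S)).card = n) {i j : ℕ}
    (hij : i < j) (hj : j < n) : blockPos S (t + 1) i < blockPos S t j := by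
  rw [blockPos_succ t hn (by omega)]
  exact firstEmpty_lt_of_mem_blockStarts ((mem_blockStarts_iff t hn _).2 ⟨i, by omega, rfl⟩)
    ((mem_blockStarts_iff t hn _).2 ⟨j, hj, rfl⟩) (blockPos_lt t hn hij hj)

theorem card_filter_evolution (t : ℤ) (hn : (blockStarts ((evolution ^ t) S)).card = n) {i : ℕ}
    (hi : i < n) {y : ℤ} (h1 : blockPos S (t + 1) i ≤ y)
    (h2 : i + 1 < n → y ≤ blockPos S t (i + 1)) :
    ((((evolution ^ t) S).filter (· < y)).card : ℤ) =
      ∑ k ∈ Finset.range (i + 1), (blockPos S (t + 1) k - blockPos S t k) := by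
  have h : ((evolution ^ t) S).filter (· < y) = (Finset.range (i + 1)).biUnion
      (fun k => Finset.Ico (blockPos S t k) (blockPos S (t + 1) k)) := by
    ext z
    simp only [Finset.mem_filter, mem_evolution_iff t hn, Finset.mem_biUnion, Finset.mem_range,
      Finset.mem_Ico]
    constructor
    · rintro ⟨⟨k, hk, h3, h4⟩, h5⟩
      refine ⟨k, ?_, h3, h4⟩
      by_contra hik
      have h6 := h2 (by omega)
      rcases (show i + 1 ≤ k by omega).eq_or_lt with rfl | h7
      · omega
      · have := blockPos_lt t hn h7 hk
        omega
    · rintro ⟨k, hk, h3, h4⟩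
      refine ⟨⟨k, by omega, h3, h4⟩, ?_⟩
      rcases (show k ≤ i by omega).eq_or_lt with rfl | h7
      · omega
      · have := blockPos_succ_lt t hn h7 hi
        have := blockPos_lt_succ t hn hi
        omega
  rw [h, Finset.card_biUnion]
  · push_cast
    refine Finset.sum_congr rfl (fun k hk => ?_)
    have := blockPos_lt_succ t hn (show k < n by have := Finset.mem_range.1 hk; omega)
    rw [Int.card_Ico]
    omega
  · intro k hk l hl hkl
    rw [Finset.mem_coe, Finset.mem_range] at hk hl
    rw [Function.onFun, Finset.disjoint_left]
    intro z hz hz'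
    rw [Finset.mem_Ico] at hz hz'
    rcases lt_or_gt_of_ne hkl with h3 | h3
    · have := blockPos_succ_lt t hn h3 (by omega)
      omega
    · have := blockPos_succ_lt t hn h3 (by omega)
      omega

theorem isMolecule_blockPos (hn : ∀ t : ℤ, (blockStarts ((evolution ^ t) S)).card = n) :
    IsMolecule n (blockPos S) := by
  have hgap : ∀ t i, i + 1 < n → blockPos S (t + 2) i ≤ blockPos S t (i + 1) := by
    intro t i hi
    by_contra! h
    have h1 : blockPos S t (i + 1) ∈ (evolution ^ t) S :=
      (mem_evolution_iff t (hn t) _).2 ⟨i + 1, hi, le_rfl, blockPos_lt_succ t (hn t) hi⟩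
    refine notMem_of_mem_step (S := (evolution ^ t) S) ?_ h1
    rw [← evolution_zpow_succ, mem_evolution_iff (t + 1) (hn _)]
    refine ⟨i, by omega, (blockPos_succ_lt t (hn t) (Nat.lt_succ_self i) hi).le, ?_⟩
    rwa [add_assoc, one_add_one_eq_two]
  -- The load of the molecule counts the balls that pass the border of box `x (t + 2) i`.
  have hload : ∀ t i, i < n →
      ∑ k ∈ Finset.range (i + 1),
          (2 * blockPos S (t + 1) k - blockPos S t k - blockPos S (t + 2) k) =
        ((((evolution ^ t) S).filter (· < blockPos S (t + 2) i)).card : ℤ) -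
          ((step ((evolution ^ t) S)).filter (· < blockPos S (t + 2) i)).card := by
    intro t i hi
    have h2 : t + 1 + 1 = t + 2 := by ring
    have h3 := blockPos_lt_succ (t + 1) (hn _) hi
    rw [h2] at h3
    rw [← evolution_zpow_succ, card_filter_evolution t (hn t) hi h3.le (hgap t i),
      card_filter_evolution (t + 1) (hn _) hi (by rw [h2]) (fun h => by
        have := blockPos_succ_lt (t + 1) (hn _) (Nat.lt_succ_self i) h
        rw [h2] at this
        exact this.le), h2, ← Finset.sum_sub_distrib]
    exact Finset.sum_congr rfl (fun k _ => by ring)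
  refine ⟨fun t i hi => (blockPos_lt_succ t (hn t) hi).le, hgap, fun t i hi => ?_,
    fun t i hi => ?_⟩
  · rw [hload t i hi, sub_nonneg, Nat.cast_le]
    exact card_filter_step_le _ _
  · by_cases h : i + 1 < n ∧ blockPos S (t + 2) i = blockPos S t (i + 1)
    · exact Or.inr h
    · left
      have h2 : t + 1 + 1 = t + 2 := by ring
      have h3 := blockPos_lt_succ (t + 1) (hn _) hi
      rw [h2] at h3
      rw [hload t i hi, sub_eq_zero, Nat.cast_inj, eq_comm]
      refine card_filter_step_eq ?_ ?_
      · rw [mem_evolution_iff t (hn t)]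
        rintro ⟨j, hj, h4, h5⟩
        rcases lt_or_ge i j with hij | hij
        · have h6 := hgap t i (by omega)
          rcases (show i + 1 ≤ j by omega).eq_or_lt with rfl | h7
          · exact h ⟨hj, by omega⟩
          · have := blockPos_lt t (hn t) h7 hj
            omega
        · rcases hij.eq_or_lt with rfl | h7
          · omega
          · have := blockPos_lt (t + 1) (hn _) h7 hi
            omega
      · rw [← evolution_zpow_succ, ← h2, blockPos_succ (t + 1) (hn _) hi]
        exact firstEmpty_notMem _ _

theorem blockSize_blockPos (t : ℤ) (hn : (blockStarts ((evolution ^ t) S)).card = n) {i : ℕ}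
    (hi : i < n) :
    (blockSize ((evolution ^ t) S) (blockPos S t i) : ℤ) =
      blockPos S (t + 1) i - blockPos S t i := by
  have := blockPos_lt_succ t hn hi
  rw [blockSize, ← blockPos_succ t hn hi]
  omega

theorem blockSizes_eq_map (t : ℤ) (hn : (blockStarts ((evolution ^ t) S)).card = n) :
    blockSizes ((evolution ^ t) S) =
      (Multiset.range n).map (fun i => blockSize ((evolution ^ t) S) (blockPos S t i)) := by
  have h : blockStarts ((evolution ^ t) S) = (Finset.range n).image (blockPos S t) := by
    ext a
    rw [mem_blockStarts_iff t hn]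
    simp
  have hinj : Set.InjOn (blockPos S t) (Finset.range n : Finset ℕ) := by
    intro i hi j hj hij
    rw [Finset.mem_coe, Finset.mem_range] at hi hj
    by_contra hne
    rcases lt_or_gt_of_ne hne with h1 | h1
    · exact (blockPos_lt t hn h1 hj).ne hij
    · exact (blockPos_lt t hn h1 hi).ne' hij
  rw [blockSizes, h, Finset.image_val_of_injOn hinj, Multiset.map_map]
  rfl

/-- A block start is the position of its block if all block sizes are distinct. -/
theorem isPositionOfBlock_blockPos (t : ℤ) (hn : (blockStarts ((evolution ^ t) S)).card = n)
    {v : ℕ → ℕ} (hv : Set.InjOn v (Set.Iio n))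
    (h : ∀ i < n, blockPos S (t + 1) i - blockPos S t i = v i) {i : ℕ} (hi : i < n) :
    IsPositionOfBlock ((evolution ^ t) S) (v i) (blockPos S t i) := by
  have hsize : ∀ j < n, blockSize ((evolution ^ t) S) (blockPos S t j) = v j := by
    intro j hj
    have := blockSize_blockPos t hn hj
    rw [h j hj] at this
    exact_mod_cast this
  intro a
  constructor
  · rintro ⟨ha, hs⟩
    obtain ⟨j, hj, rfl⟩ := (mem_blockStarts_iff t hn a).1 ha
    rw [hsize j hj] at hs
    rw [hv hj hi hs]
  · rintro rfl
    exact ⟨(mem_blockStarts_iff t hn _).2 ⟨i, hi, rfl⟩, hsize i hi⟩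

/-- An increasing enumeration is determined by its multiset of values. -/
theorem eq_of_map_range_eq {v : ℕ → ℕ} {μ : Fin n → ℕ} (hv : ∀ i j, i ≤ j → j < n → v i ≤ v j)
    (hμ : Monotone μ) (h : (Multiset.range n).map v = Finset.univ.val.map μ) (i : Fin n) :
    v i = μ i := by
  have h1 : (List.ofFn fun i : Fin n => v i) = List.ofFn μ := by
    refine List.Perm.eq_of_pairwise' (r := (· ≤ ·)) ?_ ?_ ?_
    · exact List.pairwise_ofFn.2 (fun i j hij => hv i j hij.le j.2)
    · exact List.pairwise_ofFn.2 (fun i j hij => hμ hij.le)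
    · rw [← Multiset.coe_eq_coe, ← Fin.univ_val_map, ← Fin.univ_val_map, ← h]
      rw [Fin.univ_val_map, Multiset.range, Multiset.map_coe, List.ofFn_eq_map,
        ← List.map_coe_finRange_eq_range, List.map_map]
      rfl
  exact congrFun (List.ofFn_injective h1) i

end BoxBall

/-! ### The phase shifts of a soliton system -/

theorem mainTheorem1 (n : ℕ) (μ : Fin n → ℕ) (hμ : StrictMono μ) (S : BoxBallState)
    (hS : BoxBall.HasAsymptoticBlockSizes S μ) :
    ∀ᶠ t : ℕ in Filter.atTop, ∀ i : Fin n,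
      BoxBall.IsPhaseShift S (μ i) (-(t : ℤ)) (t : ℤ)
        (∑ j ∈ Finset.Iio i, 2 * (μ j : ℤ) - ∑ _j ∈ Finset.Ioi i, 2 * (μ i : ℤ)) := by
  open BoxBall in
  obtain ⟨T₀, hT₀⟩ := eventually_atTop.1 hS
  have hn : ∀ t : ℤ, (blockStarts ((evolution ^ t) S)).card = n := by
    intro t
    have h := congrArg Multiset.card (hT₀ T₀ le_rfl)
    rw [card_blockStarts_evolution S t T₀]
    simpa [blockSizes] using h
  have hx := isMolecule_blockPos hn
  obtain ⟨X, v, hv, hlate⟩ := hx.eventually_atTop_eq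
  obtain ⟨T₁, hT₁⟩ := eventually_atTop.1 hlate
  -- The late velocities are the asymptotic block sizes.
  have hvμ : ∀ i : Fin n, v i = μ i := by
    obtain ⟨T, hT, hT'⟩ : ∃ T : ℕ, T₀ ≤ T ∧ T₁ ≤ T :=
      ⟨max T₀ T₁.toNat, le_max_left _ _, by omega⟩
    have hsize : ∀ i < n, (blockSize ((evolution ^ (T : ℤ)) S) (blockPos S T i) : ℤ) = v i := by
      intro i hi
      rw [blockSize_blockPos _ (hn _) hi, hT₁ _ hT' i hi, hT₁ _ (by omega) i hi]
      ring
    intro i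
    rw [← hsize i i.2, Nat.cast_inj]
    refine eq_of_map_range_eq
      (v := fun i => blockSize ((evolution ^ (T : ℤ)) S) (blockPos S T i)) ?_ hμ.monotone ?_ i
    · intro i j hij hj
      have h1 := hsize i (by omega)
      have h2 := hsize j hj
      have h3 := hv i j hij hj
      omega
    · rw [← blockSizes_eq_map _ (hn _), hT₀ T hT]
  have hvlt : ∀ i j, i < j → j < n → v i < v j := by
    intro i j hij hj
    have h1 := hvμ ⟨i, by omega⟩
    have h2 := hvμ ⟨j, hj⟩
    have h3 := hμ (show (⟨i, by omega⟩ : Fin n) < ⟨j, hj⟩ from hij)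
    simp only at h1 h2
    omega
  obtain ⟨T₂, hT₂⟩ := eventually_atBot.1 (hx.eventually_atBot hvlt hlate)
  have hinj : Set.InjOn (fun i => (v i).toNat) (Set.Iio n) := by
    intro i hi j hj hij
    have h1 := hvμ ⟨i, hi⟩
    have h2 := hvμ ⟨j, hj⟩
    simp only at h1 h2 hij
    rcases lt_trichotomy i j with h | h | h
    · have := hvlt i j h hj
      omega
    · exact h
    · have := hvlt j i h hi
      omega
  filter_upwards [eventually_ge_atTop (max T₁.toNat (1 - T₂).toNat)] with t ht i
  have hi := i.2
  have hμi : (fun i => (v i).toNat) i = μ i := by simp [hvμ]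
  refine ⟨blockPos S (-t) (n - 1 - i), blockPos S t i, ?_, ?_, ?_⟩
  · have h := isPositionOfBlock_blockPos (-t : ℤ) (hn _) (v := fun k => (v (n - 1 - k)).toNat)
      (i := n - 1 - i) ?_ ?_ (by omega)
    · simp only [show n - 1 - (n - 1 - (i : ℕ)) = i by omega] at h
      rwa [← hμi]
    · intro k hk l hl hkl
      rw [Set.mem_Iio] at hk hl
      have := hinj (show n - 1 - k < n by omega) (show n - 1 - l < n by omega) hkl
      omega
    · intro k hk
      have h1 := hT₂ (-t) (by omega) (n - 1 - k) (by omega)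
      have h2 := hT₂ (-t + 1) (by omega) (n - 1 - k) (by omega)
      rw [show n - 1 - (n - 1 - k) = k by omega] at h1 h2
      have h3 := hvμ ⟨n - 1 - k, by omega⟩
      simp only at h3
      rw [h1, h2, h3]
      simp only [Int.toNat_natCast]
      ring
  · rw [← hμi]
    refine isPositionOfBlock_blockPos (t : ℤ) (hn _) hinj (fun k hk => ?_) hi
    have h3 := hvμ ⟨k, hk⟩
    simp only at h3
    rw [hT₁ _ (by omega) k hk, hT₁ _ (by omega) k hk, h3]
    simp only [Int.toNat_natCast]
    ring
  · have h1 : ∑ j ∈ Finset.Iio i, 2 * (μ j : ℤ) = ∑ j ∈ Finset.range i, 2 * v j := by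
      have h2 : Finset.range i = (Finset.Iio i).map Fin.valEmbedding := by
        rw [Fin.map_valEmbedding_Iio]
        ext; simp
      rw [h2, Finset.sum_map]
      exact Finset.sum_congr rfl (fun j _ => by rw [Fin.valEmbedding_apply, hvμ])
    rw [h1, Finset.sum_const, Fin.card_Ioi, hT₂ _ (by omega) i hi, hT₁ _ (by omega) i hi, hvμ i,
      nsmul_eq_mul]
    ring
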